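/- Let $\mathcal V$ be a nontrivial variety of groups, that is, the class of all groups that satisfy some fixed set of identities $t_1\approx t_2$ between group terms, such that $\mathcal V$ contains a group with at least two elements. (1) Let $\mathbf C$ be the category whose objects are the pairs $(A,<)$ with $A\in\mathcal V$ a finite group and $<$ an arbitrary linear order on the set $A$ (no compatibility with the group operation is required), and whose morphisms $(A,<)\to(B,<)$ are the rigid epimorphisms: the surjective group homomorphisms $f:A\to B$ such that $b_1<b_2$ implies $\min f^{-1}(b_1)<\min f^{-1}(b_2)$ for all $b_1,b_2\in B$. Then $\mathbf C$ has the dual Ramsey property: for every integer $k\ge 2$ and all objects $\mathcal A,\mathcal B$ of $\mathbf C$ there is an object $\mathcal D$ of $\mathbf C$ such that for every coloring $\chi:\hom_{\mathbf C}(\mathcal D,\mathcal A)\to\{0,\dots,k-1\}$ there is a $w\in\hom_{\mathbf C}(\mathcal D,\mathcal B)$ with $|\chi(\{f\circ w: f\in\hom_{\mathbf C}(\mathcal B,\mathcal A)\})|\le 1$. (2) Let $\mathbf B$ be the category whose objects are the finite groups in $\mathcal V$ and whose morphisms are the epimorphisms, that is, the surjective group homomorphisms. Then $\mathbf B$ has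 finite dual small Ramsey degrees: for every object $A$ of $\mathbf B$ there is an integer $n\ge 1$ such that for every integer $k\ge 2$ and every object $B$ of $\mathbf B$ there is an object $D$ of $\mathbf B$ such that for every coloring $\chi:\hom_{\mathbf B}(D,A)\to\{0,\dots,k-1\}$ there is a $w\in\hom_{\mathbf B}(D,B)$ with $|\chi(\{f\circ w: f\in\hom_{\mathbf B}(B,A)\})|\le n$. (The least such $n$ is the dual small Ramsey degree of $A$.) -/

import Mathlib

open CategoryTheory

universe v u

/-! ## Ramsey properties and Ramsey degrees in a category -/

section Ramsey

variable {C : Type u} [Category.{v} C]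

/-- The arrow relation `X ⟶ (B)^A_{k,t}`: for every `k`-colouring `χ` of `hom(A, X)` there is a
morphism `w : B ⟶ X` such that `χ` takes at most `t` values on `w · hom(A, B)`. -/
def RamseyArrow (X B A : C) (k t : ℕ) : Prop :=
  ∀ χ : (A ⟶ X) → Fin k, ∃ w : B ⟶ X,
    (χ '' (Set.range fun f : A ⟶ B => f ≫ w)).ncard ≤ t

variable (C) in
/-- The (finite) Ramsey property of a category. -/
def HasRamseyProperty : Prop :=
  ∀ k : ℕ, 2 ≤ k → ∀ A B : C, ∃ X : C, RamseyArrow X B A k 1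

variable (C) in
/-- A category has the dual Ramsey property if its opposite has the Ramsey property. -/
def HasDualRamseyProperty : Prop :=
  HasRamseyProperty Cᵒᵖ

/-- The small Ramsey degree of `A`: the least positive integer `n` such that for all `k ≥ 2` and
all `B` there is an `X` with `X ⟶ (B)^A_{k,n}`, and `⊤` if there is no such integer. -/
noncomputable def smallRamseyDegree (A : C) : ℕ∞ :=
  sInf ((fun n : ℕ => (n : ℕ∞)) ''
    {n : ℕ | 1 ≤ n ∧ ∀ k : ℕ, 2 ≤ k → ∀ B : C, ∃ X : C, RamseyArrow X B A k n})

variable (C) in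
/-- All small Ramsey degrees are finite. -/
def HasFiniteSmallRamseyDegrees : Prop :=
  ∀ A : C, smallRamseyDegree A < ⊤

variable (C) in
/-- All dual small Ramsey degrees are finite. -/
def HasFiniteDualSmallRamseyDegrees : Prop :=
  HasFiniteSmallRamseyDegrees Cᵒᵖ

end Ramsey

/-! ## Varieties of groups -/

/-- Terms in the language `{1, ⁻¹, ·}` of groups over a set `X` of variables. -/
inductive GroupTerm (X : Type) : Type where
  | var : X → GroupTerm X
  | one : GroupTerm X
  | inv : GroupTerm X → GroupTerm X
  | mul : GroupTerm X → GroupTerm X → GroupTerm X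

/-- The value of a term in a group at an assignment of the variables. -/
def GroupTerm.eval {X : Type} {G : Type u} [Group G] (a : X → G) : GroupTerm X → G
  | .var x => a x
  | .one => 1
  | .inv t => (t.eval a)⁻¹
  | .mul s t => s.eval a * t.eval a

/-- The group `G` satisfies the identity `p.1 ≈ p.2`. -/
def SatisfiesIdentity (G : Type u) [Group G] (p : GroupTerm ℕ × GroupTerm ℕ) : Prop :=
  ∀ a : ℕ → G, p.1.eval a = p.2.eval a

/-- A class of groups is a variety if it is the class of all groups that satisfy some set of
identities. (A term has finitely many variables, so countably many variables suffice.) -/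
def IsGroupVariety (V : ObjectProperty GrpCat.{u}) : Prop :=
  ∃ E : Set (GroupTerm ℕ × GroupTerm ℕ), ∀ G : GrpCat.{u}, V G ↔ ∀ p ∈ E, SatisfiesIdentity G p

/-- A class of groups is nontrivial if it contains a group with at least two elements. -/
def IsNontrivialClass (V : ObjectProperty GrpCat.{u}) : Prop :=
  ∃ G : GrpCat.{u}, V G ∧ Nontrivial G

/-! ## Rigid surjections -/

/-- A rigid surjection between well-ordered chains: a surjection such that `b₁ < b₂` implies
`min f⁻¹(b₁) < min f⁻¹(b₂)`. Minima of nonempty sets exist in well-ordered chains. -/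
def IsRigidSurjection {A B : Type u} [LinearOrder A] [WellFoundedLT A]
    [LinearOrder B] [WellFoundedLT B] (f : A → B) : Prop :=
  Function.Surjective f ∧ ∀ b₁ b₂ : B, b₁ < b₂ → ∀ a₁ a₂ : A,
    IsLeast (f ⁻¹' {b₁}) a₁ → IsLeast (f ⁻¹' {b₂}) a₂ → a₁ < a₂

theorem IsRigidSurjection.id (A : Type u) [LinearOrder A] [WellFoundedLT A] :
    IsRigidSurjection (fun x : A => x) := by
  refine ⟨fun x => ⟨x, rfl⟩, ?_⟩
  rintro b₁ b₂ h a₁ a₂ ⟨h₁, -⟩ ⟨h₂, -⟩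
  simp only [Set.mem_preimage, Set.mem_singleton_iff] at h₁ h₂
  rwa [h₁, h₂]

theorem Function.Surjective.exists_isLeast_fiber {A B : Type u} [LinearOrder A] [WellFoundedLT A]
    {f : A → B} (hf : Function.Surjective f) (b : B) : ∃ a, IsLeast (f ⁻¹' {b}) a := by
  obtain ⟨a, ha, h⟩ := WellFounded.has_min (wellFounded_lt (α := A)) (f ⁻¹' {b})
    (by obtain ⟨a, rfl⟩ := hf b; exact ⟨a, rfl⟩)
  exact ⟨a, ha, fun x hx => not_lt.mp (h x hx)⟩

theorem IsRigidSurjection.comp {A B D : Type u} [LinearOrder A] [WellFoundedLT A]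
    [LinearOrder B] [WellFoundedLT B] [LinearOrder D] [WellFoundedLT D] {f : A → B} {g : B → D}
    (hg : IsRigidSurjection g) (hf : IsRigidSurjection f) :
    IsRigidSurjection (fun x => g (f x)) := by
  have key : ∀ (d : D) (b : B) (a a' : A), IsLeast (g ⁻¹' {d}) b → IsLeast (f ⁻¹' {b}) a' →
      IsLeast ((fun x => g (f x)) ⁻¹' {d}) a → a = a' := by
    intro d b a a' hb ha' ha
    have e : f a' = b := ha'.1
    have e' : g b = d := hb.1
    have e'' : g (f a) = d := ha.1
    refine le_antisymm (ha.2 (by simp [e, e'])) ?_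
    rcases (hb.2 (show f a ∈ g ⁻¹' {d} from e'')).eq_or_lt with h | h
    · exact ha'.2 h.symm
    · obtain ⟨c, hc⟩ := hf.1.exists_isLeast_fiber (f a)
      exact (hf.2 _ _ h _ _ ha' hc).le.trans (hc.2 rfl)
  refine ⟨hg.1.comp hf.1, fun d₁ d₂ h a₁ a₂ h₁ h₂ => ?_⟩
  obtain ⟨b₁, hb₁⟩ := hg.1.exists_isLeast_fiber d₁
  obtain ⟨b₂, hb₂⟩ := hg.1.exists_isLeast_fiber d₂
  obtain ⟨c₁, hc₁⟩ := hf.1.exists_isLeast_fiber b₁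
  obtain ⟨c₂, hc₂⟩ := hf.1.exists_isLeast_fiber b₂
  rw [key _ _ _ _ hb₁ hc₁ h₁, key _ _ _ _ hb₂ hc₂ h₂]
  exact hf.2 _ _ (hg.2 _ _ h _ _ hb₁ hb₂) _ _ hc₁ hc₂

/-! ## Ordered finite groups with rigid epimorphisms -/

/-- Finite groups in `V` with an arbitrary linear order (no compatibility with the group
operation is required). -/
structure OrderedFiniteGroup (V : ObjectProperty GrpCat.{u}) : Type (u + 1) where
  carrier : Type u
  [group : Group carrier]
  [linearOrder : LinearOrder carrier]
  [finite : Finite carrier]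
  mem : V (GrpCat.of carrier)

attribute [instance] OrderedFiniteGroup.group OrderedFiniteGroup.linearOrder
  OrderedFiniteGroup.finite

/-- Rigid epimorphisms: group homomorphisms that are rigid surjections. -/
@[ext]
structure RigidEpi {V : ObjectProperty GrpCat.{u}} (A B : OrderedFiniteGroup V) : Type u where
  hom : A.carrier →* B.carrier
  rigid : IsRigidSurjection (fun x => hom x)

instance (V : ObjectProperty GrpCat.{u}) : Category.{u} (OrderedFiniteGroup V) where
  Hom A B := RigidEpi A B
  id A := ⟨MonoidHom.id A.carrier, IsRigidSurjection.id A.carrier⟩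
  comp f g := ⟨g.hom.comp f.hom, g.rigid.comp f.rigid⟩

/-! ## Finite groups with epimorphisms -/

/-- Finite groups in `V`. -/
structure FiniteGroup (V : ObjectProperty GrpCat.{u}) : Type (u + 1) where
  carrier : Type u
  [group : Group carrier]
  [finite : Finite carrier]
  mem : V (GrpCat.of carrier)

attribute [instance] FiniteGroup.group FiniteGroup.finite

/-- Epimorphisms of groups in the algebraic sense: surjective homomorphisms. -/
@[ext]
structure GroupEpi {V : ObjectProperty GrpCat.{u}} (A B : FiniteGroup V) : Type u where
  hom : A.carrier →* B.carrier
  surjective : Function.Surjective hom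

instance (V : ObjectProperty GrpCat.{u}) : Category.{u} (FiniteGroup V) where
  Hom A B := GroupEpi A B
  id A := ⟨MonoidHom.id A.carrier, fun x => ⟨x, rfl⟩⟩
  comp f g := ⟨g.hom.comp f.hom, g.surjective.comp f.surjective⟩

/-! Both parts reduce to the dual Ramsey theorem for finite chains, `exists_mono_rigid`, through
relatively free groups. The group `relFree A B n` is finite and lies in the variety, and every map
from its `n` generators to `A` or to `B` extends to a homomorphism. For a homomorphism `f : B → A`
and a map `w` from the generators to `B`, composing `f` with the extension of `w` gives the
extension of `f ∘ w` (`relFree.comp_liftSnd`). So a colouring of homomorphisms becomes a colouring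
of plain maps on a chain, and the chain theorem supplies `w`. If the generators come first in the
order of the group, the extension of a rigid `w` is rigid (`exists_linearOrder_isRigid`). Without
orders, each epimorphism `B → A` is a rigid map followed by a permutation of `A`; treating all
permutations at once leaves at most `|A|!` colours.

The chain theorem is the Graham–Rothschild theorem over a one-letter alphabet, proved by induction
on the number of parameters for all alphabets at once. In the induction step the first parameter is
treated as an additional letter, which makes the colour depend only on the letters in front of that
parameter (`GrahamRothschild.prefixDetermined_succ`). The Hales–Jewett theorem then leaves only the
length of this prefix (`exists_prefix_colour`), and the pigeonhole principle removes the length. -/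

/-! ### Parameter words and their composition -/

/-- A parameter word of length `n - a` over the alphabet `{0, …, a - 1}` with `k - a` parameters, seen
as a rigid surjection of `{0, …, n - 1}` onto `{0, …, k - 1}` that fixes the numbers below `a`, and
extended to `ℕ` by a shift, so that substitution of words is composition of functions. -/
structure IsParamWord (a n k : ℕ) (f : ℕ → ℕ) : Prop where
  fix : ∀ x < a, f x = x
  lt : ∀ x < n, f x < k
  tail : ∀ x, f (n + x) = k + x
  first : ∀ j, ∃ i, f i = j ∧ ∀ i' < i, f i' < j

namespace IsParamWord

theorem id (a n : ℕ) : IsParamWord a n n id :=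
  ⟨fun _ _ => rfl, fun _ h => h, fun _ => rfl, fun j => ⟨j, rfl, fun _ h => h⟩⟩

theorem comp {a n m k : ℕ} {h g : ℕ → ℕ} (hh : IsParamWord a m k h) (hg : IsParamWord a n m g) :
    IsParamWord a n k (h ∘ g) := by
  refine ⟨fun x hx => ?_, fun x hx => hh.lt _ (hg.lt x hx), fun x => ?_, fun j => ?_⟩
  · simp [hg.fix x hx, hh.fix x hx]
  · simp [hg.tail, hh.tail]
  · obtain ⟨i, hi, hi'⟩ := hh.first j
    obtain ⟨l, hl, hl'⟩ := hg.first i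
    exact ⟨l, by simp [hl, hi], fun l' h => hi' _ (hl' l' h)⟩

theorem mono_left {a b n k : ℕ} {f : ℕ → ℕ} (hf : IsParamWord b n k f) (hab : a ≤ b) :
    IsParamWord a n k f :=
  ⟨fun x hx => hf.fix x (hx.trans_le hab), hf.lt, hf.tail, hf.first⟩

/-- A new letter is an old parameter. -/
theorem succ_left {a n k : ℕ} {f : ℕ → ℕ} (hf : IsParamWord a n k f) (h : f a = a) :
    IsParamWord (a + 1) n k f :=
  ⟨fun x hx => by
    rcases Nat.lt_succ_iff_lt_or_eq.1 hx with hx | rfl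
    exacts [hf.fix x hx, h], hf.lt, hf.tail, hf.first⟩

end IsParamWord

/-- The map that skips the value `a`. -/
def skip (a y : ℕ) : ℕ := if y < a then y else y + 1

/-- The parameter word that replaces the first parameter by the letter `b`. -/
def fillFirst (a b x : ℕ) : ℕ := if x < a then x else if x = a then b else x - 1

/-- The parameter word obtained from `g` by putting a new first parameter in front of it. -/
def insertFirst (a : ℕ) (g : ℕ → ℕ) (x : ℕ) : ℕ := if x ≤ a then x else skip a (g (x - 1))

theorem IsParamWord.insertFirst {a n k : ℕ} {g : ℕ → ℕ} (hn : a ≤ n)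
    (hg : IsParamWord a n k g) : IsParamWord (a + 1) (n + 1) (k + 1) (insertFirst a g) := by
  have hk : a ≤ k := by
    by_contra hlt
    have h1 := hg.fix k (by omega)
    have h2 := hg.lt k (by omega)
    omega
  refine ⟨fun x hx => ?_, fun x hx => ?_, fun x => ?_, fun j => ?_⟩
  · simp [_root_.insertFirst, Nat.lt_succ_iff.1 hx]
  · have := hg.lt (x - 1)
    simp only [_root_.insertFirst, skip]
    split_ifs <;> omega
  · have := hg.tail x
    have e : n + 1 + x - 1 = n + x := by omega
    simp only [_root_.insertFirst, skip, e]
    split_ifs <;> omega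
  · by_cases hj : j ≤ a
    · refine ⟨j, by simp [_root_.insertFirst, hj], fun i' hi' => ?_⟩
      simp only [_root_.insertFirst, if_pos (show i' ≤ a by omega)]
      exact hi'
    · obtain ⟨i, hi, hi'⟩ := hg.first (j - 1)
      have hia : a ≤ i := by
        by_contra h
        have := hg.fix i (by omega)
        omega
      refine ⟨i + 1, ?_, fun l hl => ?_⟩
      · simp only [_root_.insertFirst, skip, Nat.add_sub_cancel, hi]
        split_ifs <;> omega
      · have := hi' (l - 1)
        simp only [_root_.insertFirst, skip]
        split_ifs <;> omega

/-- Substituting a letter for the new first parameter commutes with `g`, because `insertFirst`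
leaves that parameter alone in its own place. -/
theorem fillFirst_insertFirst {a b : ℕ} {g : ℕ → ℕ} (hb : b < a) (hg : ∀ x < a, g x = x) (x : ℕ) :
    fillFirst a b (insertFirst a g x) = g (fillFirst a b x) := by
  have h1 := hg x
  have h2 := hg b hb
  simp only [fillFirst, insertFirst, skip]
  split_ifs <;> omega

/-- Position `a` carries a letter, which already occurs among the first `a` positions. It is
therefore not the first occurrence of any value, and deleting it keeps the word rigid. -/
theorem IsParamWord.comp_skip {a n k : ℕ} {h : ℕ → ℕ} (hn : a ≤ n)
    (hh : IsParamWord a (n + 1) k h) (hb : h a < a) : IsParamWord a n k (h ∘ skip a) := by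
  refine ⟨fun x hx => by simp [skip, hx, hh.fix x hx], fun x hx => hh.lt _ ?_, fun x => ?_,
    fun j => ?_⟩
  · simp only [skip]
    split_ifs <;> omega
  · have : skip a (n + x) = n + 1 + x := by
      simp only [skip]
      split_ifs <;> omega
    simp [this, hh.tail]
  · obtain ⟨i, hi, hi'⟩ := hh.first j
    by_cases hia : i < a
    · refine ⟨i, by simp [skip, hia, hi], fun l hl => ?_⟩
      simp only [Function.comp, skip, if_pos (hl.trans hia)]
      exact hi' l hl
    · have hne : i ≠ a := by
        rintro rfl
        have := hi' (h i) hb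
        rw [hh.fix _ hb] at this
        omega
      have e : skip a (i - 1) = i := by
        simp only [skip]
        split_ifs <;> omega
      refine ⟨i - 1, by simp [e, hi], fun l hl => hi' _ ?_⟩
      simp only [skip]
      split_ifs <;> omega

theorem comp_skip_fillFirst {a : ℕ} {h : ℕ → ℕ} (hh : ∀ x < a, h x = x) (hb : h a < a) (x : ℕ) :
    h (skip a (fillFirst a (h a) x)) = h x := by
  have := hh _ hb
  simp only [fillFirst, skip]
  rcases lt_trichotomy x a with hx | rfl | hx
  · simp [hx]
  · simp [hb, this]
  · have h1 : ¬ x < a := by omega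
    have h2 : x ≠ a := by omega
    have h3 : ¬ x - 1 < a := by omega
    have h4 : x - 1 + 1 = x := by omega
    simp [h1, h2, h3, h4]

/-! ### From monochromatic words to colours determined by the prefix -/

/-- The Graham–Rothschild property for words over `{0, …, a - 1}` with `k` parameters. -/
def GrahamRothschild (a k : ℕ) : Prop :=
  ∀ (m : ℕ) (K : Type u) [Finite K], ∃ n, ∀ χ : (ℕ → ℕ) → K,
    ∃ g, IsParamWord a (a + n) (a + m) g ∧
      ∃ c, ∀ h, IsParamWord a (a + m) (a + k) h → χ (h ∘ g) = c

/-- Colourings of words with `k` parameters can be made to depend only on the letters in front of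
the first parameter. -/
def PrefixDetermined (a k : ℕ) : Prop :=
  ∀ (m : ℕ) (K : Type u) [Finite K], ∃ n, ∀ χ : (ℕ → ℕ) → K,
    ∃ g, IsParamWord a (a + n) (a + m) g ∧
      ∀ h₁ h₂, IsParamWord a (a + m) (a + k) h₁ → IsParamWord a (a + m) (a + k) h₂ →
        ∀ p, (∀ x < p, h₁ x = h₂ x ∧ h₁ x < a) → h₁ p = a → h₂ p = a → χ (h₁ ∘ g) = χ (h₂ ∘ g)

/-- Without parameters the value `a` first occurs in the tail, so the prefix is the whole word. -/
theorem prefixDetermined_zero (a : ℕ) : PrefixDetermined.{u} a 0 := by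
  refine fun m K _ => ⟨m, fun χ => ⟨_, IsParamWord.id _ _, fun h₁ h₂ H₁ H₂ p hp h₁p h₂p => ?_⟩⟩
  have hpm : a + m ≤ p := by
    by_contra h
    have := H₁.lt p (by omega)
    omega
  congr 1
  funext x
  by_cases hx : x < p
  · exact (hp x hx).1
  · obtain ⟨y, rfl⟩ := Nat.exists_eq_add_of_le (show a + m ≤ x by omega)
    simp [H₁.tail, H₂.tail]

/-- Induction on `m`, splitting words by their entry at position `a`. If it is a parameter, the word
has `k` parameters over one more letter, where the hypothesis applies. If it is a letter, it can be
deleted, and the induction hypothesis handles all such letters together through a product colouring.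
-/
theorem GrahamRothschild.prefixDetermined_succ {a k : ℕ} (H : GrahamRothschild.{u} (a + 1) k) :
    PrefixDetermined.{u} a (k + 1) := by
  intro m
  induction m with
  | zero =>
    -- Vacuous: a word with no room beyond its first `a` positions never takes the value `a`.
    refine fun K _ => ⟨0, fun χ => ⟨_, IsParamWord.id _ _, fun h₁ h₂ H₁ H₂ p hp h₁p h₂p => ?_⟩⟩
    exfalso
    by_cases hpa : p < a
    · have := H₁.fix p hpa
      omega
    · obtain ⟨y, rfl⟩ := Nat.exists_eq_add_of_le (show a + 0 ≤ p by omega)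
      have := H₁.tail y
      omega
  | succ m ih =>
    intro K _
    obtain ⟨n', hn'⟩ := ih (Fin a → K)
    obtain ⟨n, hn⟩ := H n' K
    refine ⟨n + 1, fun χ => ?_⟩
    obtain ⟨g', Hg', c, hc⟩ := hn χ
    -- The colour of `z` records, for every letter `b`, what happens when `b` is put back at
    -- position `a`.
    obtain ⟨g, Hg, hg⟩ := hn' (fun z b => χ (z ∘ fillFirst a b ∘ g'))
    have Hg₁ := Hg.insertFirst (Nat.le_add_right _ _)
    rw [add_right_comm a 1, add_right_comm a 1] at Hg'
    refine ⟨insertFirst a g ∘ g', (Hg₁.comp Hg').mono_left (Nat.le_succ a),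
      fun h₁ h₂ H₁ H₂ p hp h₁p h₂p => ?_⟩
    have hpa : a ≤ p := by
      by_contra hlt
      have := H₁.fix p (by omega)
      omega
    rcases hpa.eq_or_lt with rfl | hlt
    · have key : ∀ h, IsParamWord a (a + (m + 1)) (a + (k + 1)) h → h a = a →
          χ (h ∘ insertFirst a g ∘ g') = c := fun h Hh ha => by
        have e := (Hh.succ_left ha).comp Hg₁
        have e1 : a + n' + 1 = a + 1 + n' := by omega
        have e2 : a + (k + 1) = a + 1 + k := by omega
        rw [e1, e2] at e
        exact hc _ e
      rw [key _ H₁ h₁p, key _ H₂ h₂p]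
    · have hb := (hp a hlt).2
      have hab := (hp a hlt).1
      have key : ∀ h, IsParamWord a (a + (m + 1)) (a + (k + 1)) h → h a < a →
          h ∘ insertFirst a g ∘ g' = ((h ∘ skip a) ∘ g) ∘ fillFirst a (h a) ∘ g' := by
        intro h Hh ha
        funext x
        simp only [Function.comp]
        rw [← fillFirst_insertFirst ha Hg.fix, comp_skip_fillFirst Hh.fix ha]
      rw [key _ H₁ hb, key _ H₂ (hab ▸ hb), ← hab]
      refine congrFun (hg _ _ (H₁.comp_skip (by omega) hb) (H₂.comp_skip (by omega) (hab ▸ hb))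
        (p - 1) (fun x hx => ?_) ?_ ?_) ⟨h₁ a, hb⟩
      · refine hp _ ?_
        simp only [skip]
        split_ifs <;> omega
      all_goals
        have e : skip a (p - 1) = p := by
          simp only [skip]
          split_ifs <;> omega
        simpa [e]

/-! ### Prefixes and the Hales–Jewett theorem -/

open Classical in
/-- The word `f` up to its first value that is at least `a`, coded as a function that is constantly
`a` from there on. -/
noncomputable def letterPrefix (a : ℕ) (f : ℕ → ℕ) (x : ℕ) : ℕ :=
  if ∀ y ≤ x, f y < a then f x else a

theorem letterPrefix_congr {a p : ℕ} {f g : ℕ → ℕ} (h : ∀ x < p, f x = g x) (hf : a ≤ f p)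
    (hg : a ≤ g p) : letterPrefix a f = letterPrefix a g := by
  funext x
  by_cases hx : x < p
  · have : (∀ y ≤ x, f y < a) ↔ ∀ y ≤ x, g y < a :=
      forall₂_congr fun y hy => by rw [h y (by omega)]
    simp [letterPrefix, this, h x hx]
  · rw [letterPrefix, letterPrefix, if_neg, if_neg]
    · exact fun H => (H p (by omega)).not_ge hg
    · exact fun H => (H p (by omega)).not_ge hf

/-- The value `a` in the code marks the end of the prefix, so the code determines both the letters
and where they stop. -/
theorem eq_of_letterPrefix_eq {a p : ℕ} {f g : ℕ → ℕ} (h : letterPrefix a f = letterPrefix a g)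
    (hf : ∀ x < p, f x < a) (hp : f p = a) :
    (∀ x < p, f x = g x) ∧ a ≤ g p := by
  have key : ∀ x < p, (∀ y < x, g y < a) → f x = g x := by
    intro x hx hg
    have hfx : letterPrefix a f x = f x := if_pos fun y hy => hf y (by omega)
    have := hf x hx
    rw [h, letterPrefix] at hfx
    split_ifs at hfx <;> omega
  have key' : ∀ x < p, f x = g x := by
    intro x
    induction x using Nat.strong_induction_on with
    | _ x ih =>
      refine fun hx => key x hx fun y hy => ?_
      rw [← ih y hy (by omega)]
      exact hf y (by omega)
  refine ⟨key', ?_⟩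
  by_contra hlt
  have h1 : letterPrefix a f p = a := by
    simp only [letterPrefix, hp, ite_self]
  have h2 : letterPrefix a g p = g p := if_pos fun y hy => by
    rcases hy.eq_or_lt with rfl | hy
    · omega
    · rw [← key' y hy]
      exact hf y hy
  rw [h] at h1
  omega

/-- The word that consists of the letters below `a`, then the `n` letters of `u`, and then the
letters of `f` after the first `a`. -/
def glue (a n : ℕ) (u f : ℕ → ℕ) (x : ℕ) : ℕ :=
  if x < a then x else if x < a + n then u (x - a) else f (x - n)

theorem letterPrefix_glue {a n : ℕ} {u f : ℕ → ℕ} (hu : ∀ i < n, u i < a)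
    (hf : ∀ x < a, f x = x) :
    letterPrefix a (glue a n u f) = glue a n u (letterPrefix a f) := by
  have hlt : ∀ x < a + n, glue a n u f x < a := by
    intro x hx
    have := hu (x - a)
    simp only [glue]
    split_ifs <;> omega
  funext x
  by_cases hx : x < a + n
  · rw [letterPrefix, if_pos fun y hy => hlt y (by omega)]
    simp only [glue, hx, if_true]
  · have h1 : (∀ y ≤ x, glue a n u f y < a) ↔ ∀ y ≤ x - n, f y < a := by
      refine ⟨fun H y hy => ?_, fun H y hy => ?_⟩
      · by_cases hya : y < a
        · rwa [hf y hya]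
        · have := H (y + n) (by omega)
          simp only [glue] at this
          rwa [if_neg (by omega), if_neg (by omega), Nat.add_sub_cancel] at this
      · by_cases hya : y < a + n
        · exact hlt y hya
        · have := H (y - n) (by omega)
          simp only [glue]
          rwa [if_neg (by omega), if_neg (by omega)]
    have h2 : ∀ f', glue a n u f' x = f' (x - n) := fun f' => by
      simp only [glue]
      rw [if_neg (by omega), if_neg hx]
    simp only [letterPrefix, h1, h2]

/-- `f` fixes the numbers below `a`, and `a + p` is the first place where its value is not below `a`;
the value there is `a`. -/
structure FirstParamAt (a p : ℕ) (f : ℕ → ℕ) : Prop where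
  fix : ∀ x < a, f x = x
  lt : ∀ x < a + p, f x < a
  eq : f (a + p) = a

theorem IsParamWord.exists_firstParamAt {a n k : ℕ} {f : ℕ → ℕ} (hf : IsParamWord a n k f) :
    ∃ p, FirstParamAt a p f := by
  obtain ⟨i, hi, hi'⟩ := hf.first a
  have hai : a ≤ i := by
    by_contra h
    have := hf.fix i (by omega)
    omega
  obtain ⟨p, rfl⟩ := Nat.exists_eq_add_of_le hai
  exact ⟨p, hf.fix, hi', hi⟩

theorem FirstParamAt.comp_skip {a p : ℕ} {h : ℕ → ℕ} (H : FirstParamAt a (p + 1) h) :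
    FirstParamAt a p (h ∘ skip a) := by
  refine ⟨fun x hx => by simp [skip, hx, H.fix x hx], fun x hx => H.lt _ ?_, ?_⟩
  · simp only [skip]
    split_ifs <;> omega
  · have : skip a (a + p) = a + (p + 1) := by simp [skip, add_assoc]
    simpa [this] using H.eq

/-- The words coded by `letterPrefix` form a finite set if their length is bounded. -/
theorem finite_prefixes (a n : ℕ) : {f : ℕ → ℕ | ∀ x, f x ≤ a ∧ (n ≤ x → f x = a)}.Finite := by
  refine Set.Finite.of_injOn (f := fun f (i : Fin n) => (Fin.ofNat (a + 1) (f i)))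
    (t := Set.univ) (fun _ _ => Set.mem_univ _) (fun f hf g hg h => ?_) Set.finite_univ
  funext x
  by_cases hx : x < n
  · have := congrArg Fin.val (congrFun h ⟨x, hx⟩)
    simpa [Fin.ofNat, Nat.mod_eq_of_lt (Nat.lt_succ_of_le (hf x).1),
      Nat.mod_eq_of_lt (Nat.lt_succ_of_le (hg x).1)] using this
  · rw [(hf x).2 (by omega), (hg x).2 (by omega)]

/-- By position `a + n` the word `g` has reached the value `a + p`, which `h` sends to `a`. This
bounds the prefixes by a finite set, which can then index the colours for Hales–Jewett. -/
theorem FirstParamAt.letterPrefix_comp_mem {a m n p : ℕ} {h g : ℕ → ℕ} (H : FirstParamAt a p h)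
    (hp : p ≤ m) (hg : IsParamWord a (a + n) (a + m) g) :
    letterPrefix a (h ∘ g) ∈ {f : ℕ → ℕ | ∀ x, f x ≤ a ∧ (a + n ≤ x → f x = a)} := by
  refine fun x => ⟨?_, fun hx => ?_⟩
  · simp only [letterPrefix]
    split_ifs with h1
    exacts [(h1 x le_rfl).le, le_rfl]
  · obtain ⟨i, hi, hi'⟩ := hg.first (a + p)
    have hix : i ≤ a + n := by
      by_contra hlt
      have h1 := hi' (a + n) (by omega)
      have h2 := hg.tail 0
      simp only [add_zero] at h2
      omega
    refine if_neg fun hlt => ?_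
    have := hlt i (by omega)
    simp [hi, H.eq] at this

/-- The variable of `ℓ` becomes the new first parameter; `skip a` moves the parameters of `g` up by
one to make room for it. -/
theorem IsParamWord.glue {a n k N : ℕ} {ℓ g : ℕ → ℕ} (hℓ : ∀ i < N, ℓ i ≤ a)
    (hℓ' : ∃ i < N, ℓ i = a) (hn : a ≤ n) (hk : a ≤ k) (hg : IsParamWord a n k g) :
    IsParamWord a (n + N) (k + 1) (glue a N ℓ (skip a ∘ g)) := by
  refine ⟨fun x hx => by simp [_root_.glue, hx], fun x hx => ?_, fun x => ?_, fun j => ?_⟩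
  · have h1 := hℓ (x - a)
    have h2 := hg.lt (x - N)
    simp only [_root_.glue, skip, Function.comp]
    split_ifs <;> omega
  · have h1 := hg.tail x
    have e : n + N + x - N = n + x := by omega
    simp only [_root_.glue, skip, Function.comp, e]
    split_ifs <;> omega
  · rcases lt_trichotomy j a with hj | rfl | hj
    · refine ⟨j, by simp [_root_.glue, hj], fun l hl => ?_⟩
      simp only [_root_.glue]
      rw [if_pos (by omega)]
      exact hl
    · classical
      have hs := Nat.find_spec hℓ'
      have hm : ∀ l < Nat.find hℓ', ¬ (l < N ∧ ℓ l = j) := fun l hl => Nat.find_min hℓ' hl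
      refine ⟨j + Nat.find hℓ', ?_, fun l hl => ?_⟩
      · simp only [_root_.glue]
        rw [if_neg (by omega), if_pos (by omega), Nat.add_sub_cancel_left]
        exact hs.2
      · have h1 := hm (l - j)
        have h2 := hℓ (l - j)
        simp only [_root_.glue, skip, Function.comp]
        split_ifs <;> omega
    · obtain ⟨i, hi, hi'⟩ := hg.first (j - 1)
      have hia : a ≤ i := by
        by_contra h
        have := hg.fix i (by omega)
        omega
      refine ⟨i + N, ?_, fun l hl => ?_⟩
      · simp only [_root_.glue, skip, Function.comp, Nat.add_sub_cancel, hi]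
        split_ifs <;> omega
      · have h1 := hi' (l - N)
        have h2 := hℓ (l - a)
        simp only [_root_.glue, skip, Function.comp]
        split_ifs <;> omega

/-- The Hales–Jewett theorem for words over `{0, …, a - 1}`, with `a` as the variable. -/
theorem exists_mono_line (a : ℕ) (K : Type u) [Finite K] : ∃ N, ∀ χ : (ℕ → ℕ) → K,
    ∃ ℓ : ℕ → ℕ, (∀ i < N, ℓ i ≤ a) ∧ (∃ i < N, ℓ i = a) ∧
      ∃ c, ∀ b < a, χ (fun i => if i < N then if ℓ i = a then b else ℓ i else 0) = c := by
  obtain ⟨N, hN⟩ := Combinatorics.Subspace.exists_mono_in_high_dimension_fin (Fin a) K Unit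
  refine ⟨N, fun χ => ?_⟩
  obtain ⟨l, c, hl⟩ := hN (fun u => χ (fun i => if h : i < N then u ⟨i, h⟩ else 0))
  refine ⟨fun i => if h : i < N then Sum.elim (fun b : Fin a => (b : ℕ)) (fun _ => a) (l.idxFun ⟨i, h⟩) else 0,
    fun i hi => ?_, ?_, c, fun b hb => ?_⟩
  · simp only [hi, dif_pos]
    cases l.idxFun ⟨i, hi⟩ with
    | inl b => exact b.2.le
    | inr b => exact le_rfl
  · obtain ⟨i, hi⟩ := l.proper ()
    exact ⟨i, i.2, by simp [hi]⟩
  · rw [← hl fun _ => ⟨b, hb⟩]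
    congr 1
    funext i
    by_cases hi : i < N
    · simp only [hi, dif_pos, if_true, Combinatorics.Subspace.coe_apply]
      cases l.idxFun ⟨i, hi⟩ with
      | inl b => simp [b.2.ne]
      | inr b => simp
    · simp [hi]

/-- Colourings of prefixes can be made to depend only on the length of the argument. -/
theorem exists_prefix_colour (a : ℕ) (ha : 0 < a) (m : ℕ) : ∀ (K : Type u) [Finite K],
    ∃ n, ∀ ψ : (ℕ → ℕ) → K, ∃ g, IsParamWord a (a + n) (a + m) g ∧
      ∀ p ≤ m, ∀ h₁ h₂, FirstParamAt a p h₁ → FirstParamAt a p h₂ →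
        ψ (letterPrefix a (h₁ ∘ g)) = ψ (letterPrefix a (h₂ ∘ g)) := by
  induction m with
  | zero =>
    refine fun K _ => ⟨0, fun ψ => ⟨_, IsParamWord.id _ _, fun p hp h₁ h₂ H₁ H₂ => ?_⟩⟩
    obtain rfl : p = 0 := by omega
    congr 1
    exact letterPrefix_congr (p := a) (fun x hx => by simp [H₁.fix x hx, H₂.fix x hx])
      H₁.eq.ge H₂.eq.ge
  | succ m ih =>
    intro K _
    obtain ⟨n, hn⟩ := ih K
    set S := {f : ℕ → ℕ | ∀ x, f x ≤ a ∧ (a + n ≤ x → f x = a)}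
    have : Finite S := finite_prefixes a (a + n)
    -- A block `u` is coloured by the whole map that sends a continuation `f` to the colour of `u`
    -- followed by `f`. On a monochromatic line, the letter in the variable then has no influence,
    -- whatever follows.
    obtain ⟨N, hN⟩ := exists_mono_line a (S → K)
    refine ⟨n + N, fun ψ => ?_⟩
    obtain ⟨ℓ, hℓ, hℓ', c, hc⟩ := hN (fun u f => ψ (glue a N u f))
    obtain ⟨g, Hg, hg⟩ := hn fun f =>
      ψ (glue a N (fun i => if i < N then if ℓ i = a then 0 else ℓ i else 0) f)
    refine ⟨glue a N ℓ (skip a ∘ g),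
      add_assoc a n N ▸ Hg.glue hℓ hℓ' (Nat.le_add_right _ _) (Nat.le_add_right _ _),
      fun p hp h₁ h₂ H₁ H₂ => ?_⟩
    cases p with
    | zero =>
      -- Here both words send the variable of `ℓ` to `a`, so both prefixes end at its first
      -- occurrence and contain only fixed letters.
      congr 1
      classical
      have hs := Nat.find_spec hℓ'
      have hm : ∀ l < Nat.find hℓ', ¬ (l < N ∧ ℓ l = a) := fun l hl => Nat.find_min hℓ' hl
      have hfirst : glue a N ℓ (skip a ∘ g) (a + Nat.find hℓ') = a := by
        simp only [glue]
        rw [if_neg (by omega), if_pos (by omega), Nat.add_sub_cancel_left]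
        exact hs.2
      have hbefore : ∀ x < a + Nat.find hℓ', glue a N ℓ (skip a ∘ g) x < a := by
        intro x hx
        have h1 := hm (x - a)
        have h2 := hℓ (x - a)
        simp only [glue]
        split_ifs <;> omega
      refine letterPrefix_congr (p := a + Nat.find hℓ') (fun x hx => ?_) ?_ ?_
      · simp [H₁.fix _ (hbefore x hx), H₂.fix _ (hbefore x hx)]
      · simpa [hfirst] using H₁.eq.ge
      · simpa [hfirst] using H₂.eq.ge
    | succ p =>
      have key : ∀ h, FirstParamAt a (p + 1) h →
          ψ (letterPrefix a (h ∘ glue a N ℓ (skip a ∘ g))) =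
            ψ (glue a N (fun i => if i < N then if ℓ i = a then 0 else ℓ i else 0)
              (letterPrefix a ((h ∘ skip a) ∘ g))) := by
        intro h H
        have hb := H.lt a (by omega)
        have e : h ∘ glue a N ℓ (skip a ∘ g) =
            glue a N (fun i => if i < N then if ℓ i = a then h a else ℓ i else 0)
              ((h ∘ skip a) ∘ g) := by
          funext x
          simp only [Function.comp, glue]
          split_ifs with h1 h2 h3 h4
          · exact H.fix x h1
          · rw [h4]
          · exact H.fix _ (lt_of_le_of_ne (hℓ _ h3) h4)
          · omega
          · rfl
        rw [e, letterPrefix_glue]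
        · have hmem := H.comp_skip.letterPrefix_comp_mem (by omega) Hg
          -- The letter `h a` is exchanged for `0`, which turns the colour into the one that the
          -- induction hypothesis controls.
          exact congrFun ((hc _ hb).trans (hc 0 ha).symm) ⟨_, hmem⟩
        · intro i hi
          have := hℓ i hi
          simp only [hi, if_true]
          split_ifs <;> omega
        · intro x hx
          simpa [Hg.fix x hx] using H.comp_skip.fix x hx
      rw [key _ H₁, key _ H₂]
      exact hg p (by omega) _ _ H₁.comp_skip H₂.comp_skip

/-! ### Selecting the places of the parameters -/

open Classical in
/-- The word that has a parameter in the places that satisfy `q`, and the letter `0` elsewhere. -/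
noncomputable def selectParams (a : ℕ) (q : ℕ → Prop) (x : ℕ) : ℕ :=
  if x < a then x else if q (x - a) then a + Nat.count q (x - a) else 0

theorem setOfPred_infinite_of_forall_ge {q : ℕ → Prop} {M : ℕ} (hM : ∀ i, M ≤ i → q i) :
    (Set.ofPred q).Infinite :=
  Set.infinite_of_forall_exists_gt fun n => ⟨n + M + 1, hM _ (by omega), by omega⟩

open Classical in
theorem isParamWord_selectParams {a m M : ℕ} {q : ℕ → Prop} (ha : 0 < a)
    (hM : ∀ i, M ≤ i → q i) (hm : Nat.count q M = m) :
    IsParamWord a (a + M) (a + m) (selectParams a q) := by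
  have hinf := setOfPred_infinite_of_forall_ge hM
  refine ⟨fun x hx => by simp [selectParams, hx], fun x hx => ?_, fun x => ?_, fun j => ?_⟩
  · simp only [selectParams]
    split_ifs with h1 h2
    · omega
    · have := Nat.count_strict_mono h2 (show x - a < M by omega)
      omega
    · omega
  · have e : a + M + x - a = M + x := by omega
    have h : Nat.count (fun k => q (M + k)) x = x :=
      Nat.count_iff_forall.2 fun k _ => hM _ (by omega)
    simp only [selectParams, e]
    rw [if_neg (by omega), if_pos (hM _ (by omega)), Nat.count_add, h, hm, add_assoc]
  · by_cases hj : j < a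
    · refine ⟨j, by simp [selectParams, hj], fun i hi => ?_⟩
      simp [selectParams, hi.trans hj, hi]
    · refine ⟨a + Nat.nth q (j - a), ?_, fun i hi => ?_⟩
      · simp only [selectParams, Nat.add_sub_cancel_left]
        rw [if_neg (by omega), if_pos (Nat.nth_mem_of_infinite hinf _),
          Nat.count_nth_of_infinite hinf]
        omega
      · simp only [selectParams]
        split_ifs with h1 h2
        · omega
        · have := Nat.count_strict_mono h2 (show i - a < Nat.nth q (j - a) by omega)
          rw [Nat.count_nth_of_infinite hinf] at this
          omega
        · omega

/-- The unselected places receive the letter `0`, so the first parameter of `h` moves to the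
selected place with index `p`. -/
theorem FirstParamAt.comp_selectParams {a p : ℕ} {h : ℕ → ℕ} {q : ℕ → Prop} (ha : 0 < a)
    (hq : (Set.ofPred q).Infinite) (H : FirstParamAt a p h) :
    FirstParamAt a (Nat.nth q p) (h ∘ selectParams a q) := by
  classical
  refine ⟨fun x hx => by simp [selectParams, hx, H.fix x hx], fun x hx => H.lt _ ?_, ?_⟩
  · simp only [selectParams]
    split_ifs with h1 h2
    · omega
    · have := Nat.count_strict_mono h2 (show x - a < Nat.nth q p by omega)
      rw [Nat.count_nth_of_infinite hq] at this
      omega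
    · omega
  · simp [selectParams, Nat.nth_mem_of_infinite hq, Nat.count_nth_of_infinite hq, H.eq]

theorem firstParamAt_const (a p : ℕ) (ha : 0 < a) :
    FirstParamAt a p (fun x => if x < a then x else if x < a + p then 0 else a) := by
  refine ⟨fun x hx => by simp [hx], fun x hx => ?_, by simp⟩
  split_ifs <;> omega

/-- Among sufficiently many places, `m` have the same colour; they are coded as a predicate that
holds from some point on. -/
theorem exists_mono_places (m : ℕ) (K : Type u) [Finite K] : ∃ M, ∀ c : ℕ → K,
    ∃ (q : ℕ → Prop) (_ : DecidablePred q) (c₀ : K), (∀ i, M ≤ i → q i) ∧ Nat.count q M = m ∧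
      ∀ i < M, q i → c i = c₀ := by
  classical
  have := Fintype.ofFinite K
  -- With this many places, some colour occurs more than `m` times; exactly `m` of its places are
  -- kept.
  refine ⟨Fintype.card K * m + 1, fun c => ?_⟩
  obtain ⟨c₀, -, hc₀⟩ := Finset.exists_lt_card_fiber_of_mul_lt_card_of_maps_to
    (s := Finset.range (Fintype.card K * m + 1)) (t := Finset.univ) (f := c) (n := m)
    (fun _ _ => Finset.mem_univ _) (by simp)
  obtain ⟨t, ht, htm⟩ := Finset.exists_subset_card_eq hc₀.le
  have htM : ∀ i ∈ t, i < Fintype.card K * m + 1 ∧ c i = c₀ := fun i hi => by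
    simpa using ht hi
  refine ⟨fun i => i ∈ t ∨ Fintype.card K * m + 1 ≤ i, inferInstance, c₀, fun i hi => Or.inr hi,
    ?_, fun i hi hq => (htM i (hq.resolve_right (by omega))).2⟩
  rw [Nat.count_eq_card_filter_range]
  refine (congrArg Finset.card ?_).trans htm
  ext i
  simp only [Finset.mem_filter, Finset.mem_range]
  constructor
  · rintro ⟨h1, h2⟩
    exact h2.resolve_right (by omega)
  · exact fun hi => ⟨(htM i hi).1, Or.inl hi⟩

/-- The colour is first pushed down to a function of the prefix, and then to a function of the
prefix length. -/
theorem PrefixDetermined.exists_colour {a k : ℕ} (H : PrefixDetermined.{u} a k) (ha : 0 < a)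
    (m : ℕ) (K : Type u) [Finite K] : ∃ n, ∀ χ : (ℕ → ℕ) → K, ∃ (g : ℕ → ℕ) (c : ℕ → K),
      IsParamWord a (a + n) (a + m) g ∧ ∀ p ≤ m, ∀ r h, IsParamWord a (a + m) r h →
        r = a + k → FirstParamAt a p h → χ (h ∘ g) = c p := by
  classical
  obtain ⟨M, hM⟩ := exists_prefix_colour a ha m K
  obtain ⟨n, hn⟩ := H M K
  refine ⟨n, fun χ => ?_⟩
  obtain ⟨g₁, Hg₁, hg₁⟩ := hn χ
  -- A prefix gets the colour of an arbitrary word that has it; the value on other functions is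
  -- irrelevant.
  let ψ : (ℕ → ℕ) → K := fun f =>
    if h : ∃ h, IsParamWord a (a + M) (a + k) h ∧ letterPrefix a h = f then χ (h.choose ∘ g₁)
    else χ id
  have hψ : ∀ h, IsParamWord a (a + M) (a + k) h → ψ (letterPrefix a h) = χ (h ∘ g₁) := by
    intro h Hh
    have hex : ∃ h', IsParamWord a (a + M) (a + k) h' ∧ letterPrefix a h' = letterPrefix a h :=
      ⟨h, Hh, rfl⟩
    have hs := hex.choose_spec
    obtain ⟨p, hp⟩ := Hh.exists_firstParamAt
    obtain ⟨p', hp'⟩ := hs.1.exists_firstParamAt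
    have h1 := eq_of_letterPrefix_eq hs.2.symm hp.lt hp.eq
    have h2 := eq_of_letterPrefix_eq hs.2 hp'.lt hp'.eq
    have hpp : p' = p := by
      rcases lt_trichotomy p p' with hlt | heq | hlt
      · have := hp'.lt (a + p) (by omega)
        omega
      · exact heq.symm
      · have := hp.lt (a + p') (by omega)
        omega
    subst hpp
    simp only [ψ, dif_pos hex]
    exact hg₁ _ _ hs.1 Hh (a + p') (fun x hx => ⟨(h1.1 x hx).symm, hp'.lt x hx⟩) hp'.eq hp.eq
  obtain ⟨g₂, Hg₂, hg₂⟩ := hM ψ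
  refine ⟨g₂ ∘ g₁, fun p => ψ (letterPrefix a
    ((fun x => if x < a then x else if x < a + p then 0 else a) ∘ g₂)), Hg₂.comp Hg₁, ?_⟩
  rintro p hp _ h Hh rfl Hp
  rw [← Function.comp_assoc, ← hψ _ (Hh.comp Hg₂)]
  exact hg₂ p hp _ _ Hp (firstParamAt_const a p ha)

theorem PrefixDetermined.grahamRothschild_zero {a : ℕ} (H : PrefixDetermined.{u} a 0)
    (ha : 0 < a) : GrahamRothschild.{u} a 0 := by
  intro m K _
  obtain ⟨n, hn⟩ := H.exists_colour ha m K
  refine ⟨n, fun χ => ?_⟩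
  obtain ⟨g, c, Hg, hg⟩ := hn χ
  exact ⟨g, Hg, c m, fun h Hh => hg m le_rfl _ h Hh rfl ⟨Hh.fix, Hh.lt, Hh.tail 0⟩⟩

/-- With at least one parameter, the first one lies at a place `p < m`. Selecting `m` places of
equal colour sends it to one of these. -/
theorem PrefixDetermined.grahamRothschild_succ {a k : ℕ} (H : PrefixDetermined.{u} a (k + 1))
    (ha : 0 < a) : GrahamRothschild.{u} a (k + 1) := by
  intro m K _
  obtain ⟨M, hM⟩ := exists_mono_places m K
  obtain ⟨n, hn⟩ := H.exists_colour ha M K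
  refine ⟨n, fun χ => ?_⟩
  obtain ⟨g, c, Hg, hg⟩ := hn χ
  obtain ⟨q, _, c₀, hq, hqm, hc⟩ := hM c
  have hinf := setOfPred_infinite_of_forall_ge hq
  have Hs : IsParamWord a (a + M) (a + m) (selectParams a q) :=
    isParamWord_selectParams ha hq (by convert hqm)
  refine ⟨selectParams a q ∘ g, Hs.comp Hg, c₀, fun h Hh => ?_⟩
  obtain ⟨p, hp⟩ := Hh.exists_firstParamAt
  have hpm : p < m := by
    by_contra hle
    obtain ⟨y, rfl⟩ := Nat.exists_eq_add_of_le (show m ≤ p by omega)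
    have h1 := Hh.tail y
    have h2 := hp.eq
    rw [← add_assoc] at h2
    omega
  have hlt : Nat.nth q p < M := Nat.nth_lt_of_lt_count (hqm ▸ hpm)
  rw [← Function.comp_assoc,
    hg _ hlt.le _ _ (Hh.comp Hs) rfl (hp.comp_selectParams ha hinf)]
  exact hc _ hlt (Nat.nth_mem_of_infinite hinf p)

/-- The **Graham–Rothschild theorem** for words over a nonempty alphabet. -/
theorem grahamRothschild (k : ℕ) : ∀ a, 0 < a → GrahamRothschild.{u} a k := by
  induction k with
  | zero => exact fun a ha => (prefixDetermined_zero a).grahamRothschild_zero ha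
  | succ k ih => exact fun a ha => (ih (a + 1) a.succ_pos).prefixDetermined_succ.grahamRothschild_succ ha

/-! ### Rigid maps of finite chains -/

/-- Every `b` has a preimage such that all smaller elements are sent to elements smaller than `b`. -/
def IsRigid {A B : Type*} [LT A] [LT B] (f : A → B) : Prop :=
  ∀ b, ∃ a, f a = b ∧ ∀ a' < a, f a' < b

theorem IsRigidSurjection.isRigid {A B : Type u} [LinearOrder A] [WellFoundedLT A]
    [LinearOrder B] [WellFoundedLT B] {f : A → B} (hf : IsRigidSurjection f) : IsRigid f := by
  intro b
  obtain ⟨a, ha⟩ := hf.1.exists_isLeast_fiber b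
  refine ⟨a, ha.1, fun a' ha' => ?_⟩
  by_contra! hlt
  rcases hlt.eq_or_lt with h | h
  · exact ha'.not_ge (ha.2 h.symm)
  · obtain ⟨a₂, ha₂⟩ := hf.1.exists_isLeast_fiber (f a')
    exact (ha'.trans (hf.2 _ _ h _ _ ha ha₂)).not_ge (ha₂.2 rfl)

theorem IsRigid.isRigidSurjection {A B : Type u} [LinearOrder A] [WellFoundedLT A]
    [LinearOrder B] [WellFoundedLT B] {f : A → B} (hf : IsRigid f) : IsRigidSurjection f := by
  refine ⟨fun b => (hf b).imp fun _ h => h.1, fun b₁ b₂ h a₁ a₂ h₁ h₂ => ?_⟩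
  obtain ⟨a, ha, ha'⟩ := hf b₁
  refine (h₁.2 ha).trans_lt ?_
  rcases lt_trichotomy a a₂ with hlt | rfl | hlt
  · exact hlt
  · exact absurd (ha.symm.trans h₂.1) h.ne
  · have := ha' a₂ hlt
    rw [show f a₂ = b₂ from h₂.1] at this
    exact absurd this h.not_gt

/-- A rigid map between finite chains, as a parameter word. -/
theorem IsRigid.exists_isParamWord {m k : ℕ} {f : Fin (m + 1) → Fin (k + 1)} (hf : IsRigid f) :
    ∃ h, IsParamWord 1 (1 + m) (1 + k) h ∧ ∀ i : Fin (m + 1), h i = f i := by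
  refine ⟨fun x => if hx : x < m + 1 then f ⟨x, hx⟩ else 1 + k + (x - (1 + m)),
    ⟨fun x hx => ?_, fun x hx => ?_, fun x => ?_, fun j => ?_⟩, fun i => dif_pos i.2⟩
  · obtain rfl : x = 0 := by omega
    obtain ⟨a, ha, ha'⟩ := hf 0
    obtain rfl : a = 0 := by
      by_contra h
      exact (Fin.not_lt_zero _) (ha' 0 (Fin.pos_of_ne_zero h))
    simp [ha]
  · rw [dif_pos (by omega)]
    have := (f ⟨x, by omega⟩).2
    omega
  · rw [dif_neg (by omega)]
    omega
  · by_cases hj : j < k + 1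
    · obtain ⟨a, ha, ha'⟩ := hf ⟨j, hj⟩
      refine ⟨a, (dif_pos a.2).trans (congrArg Fin.val ha), fun i hi => ?_⟩
      rw [dif_pos (by omega)]
      exact ha' ⟨i, by omega⟩ hi
    · refine ⟨1 + m + (j - (1 + k)), ?_, fun i hi => ?_⟩
      · rw [dif_neg (by omega)]
        omega
      · split_ifs with h
        · have := (f ⟨i, h⟩).2
          omega
        · omega

theorem IsRigid.comp_orderIso {A B D : Type*} [Preorder A] [Preorder B] [LT D] {f : B → D}
    (hf : IsRigid f) (e : A ≃o B) : IsRigid (f ∘ e) := by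
  intro d
  obtain ⟨b, hb, hb'⟩ := hf d
  exact ⟨e.symm b, by simp [hb], fun a' ha' => hb' _ (by rwa [← e.lt_symm_apply])⟩

theorem IsRigid.orderIso_comp {A B D : Type*} [LT A] [Preorder B] [Preorder D] {f : A → B}
    (hf : IsRigid f) (e : B ≃o D) : IsRigid (e ∘ f) := by
  intro d
  obtain ⟨a, ha, ha'⟩ := hf (e.symm d)
  exact ⟨a, by simp [ha], fun a' h => by simpa [e.lt_symm_apply] using ha' a' h⟩

theorem exists_orderIso_fin_succ (A : Type*) [LinearOrder A] [Finite A] [Nonempty A] :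
    ∃ k, Nonempty (A ≃o Fin (k + 1)) := by
  have := Fintype.ofFinite A
  obtain ⟨k, hk⟩ := Nat.exists_eq_succ_of_ne_zero (Fintype.card_ne_zero (α := A))
  exact ⟨k, ⟨(Fintype.orderIsoFinOfCardEq A hk).symm⟩⟩

/-- The **dual Ramsey theorem** of Graham and Rothschild for finite chains. -/
theorem exists_mono_rigid (A B : Type*) [LinearOrder A] [Finite A] [Nonempty A] [LinearOrder B]
    [Finite B] [Nonempty B] (K : Type*) [Finite K] : ∃ n, ∀ χ : (Fin n → A) → K,
      ∃ w : Fin n → B, IsRigid w ∧ ∃ c, ∀ f : B → A, IsRigid f → χ (f ∘ w) = c := by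
  obtain ⟨k, ⟨eA⟩⟩ := exists_orderIso_fin_succ A
  obtain ⟨m, ⟨eB⟩⟩ := exists_orderIso_fin_succ B
  -- The single letter is the least element, which rigid maps preserve; the other elements are the
  -- parameters.
  obtain ⟨n, hn⟩ := grahamRothschild k 1 one_pos m K
  refine ⟨1 + n, fun χ => ?_⟩
  obtain ⟨g, Hg, c, hc⟩ := hn fun F => χ fun i => eA.symm (Fin.ofNat (k + 1) (F i))
  have hlt : ∀ i : Fin (1 + n), g i < m + 1 := fun i => add_comm 1 m ▸ Hg.lt i i.2
  refine ⟨eB.symm ∘ fun i => ⟨g i, hlt i⟩, IsRigid.orderIso_comp (fun b => ?_) eB.symm, c,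
    fun f hf => ?_⟩
  · obtain ⟨i, hi, hi'⟩ := Hg.first b
    have hin : i < 1 + n := by
      by_contra hle
      obtain ⟨y, rfl⟩ := Nat.exists_eq_add_of_le (show 1 + n ≤ i by omega)
      have := Hg.tail y
      omega
    exact ⟨⟨i, hin⟩, Fin.ext hi, fun a' ha' => hi' a' ha'⟩
  · obtain ⟨h, Hh, hh⟩ := ((hf.comp_orderIso eB.symm).orderIso_comp eA).exists_isParamWord
    rw [← hc h Hh]
    congr 1
    funext i
    have := hh ⟨g i, hlt i⟩
    simp only [Function.comp] at this ⊢
    rw [this]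
    simp

/-- Every surjection between finite chains is rigid after a permutation of the target. -/
theorem exists_perm_isRigid {A B : Type*} [LinearOrder A] [Finite A] [LinearOrder B] [Finite B]
    {f : B → A} (hf : Function.Surjective f) : ∃ σ : Equiv.Perm A, IsRigid (σ.symm ∘ f) := by
  have := Fintype.ofFinite A
  have hex : ∀ a, ∃ b, f b = a ∧ ∀ b', f b' = a → b ≤ b' := fun a => by
    obtain ⟨b, hb, hb'⟩ := WellFounded.has_min (wellFounded_lt (α := B)) (f ⁻¹' {a}) (hf a)
    exact ⟨b, hb, fun b' h => not_lt.1 (hb' b' h)⟩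
  choose μ hμ hμ' using hex
  have hinj : Function.Injective μ := Function.LeftInverse.injective hμ
  have hcard : Fintype.card (Set.range μ) = Fintype.card A :=
    (Fintype.card_congr (Equiv.ofInjective μ hinj)).symm
  -- `μ` picks least preimages, and `τ` lists them in increasing order along `A`; the permutation
  -- compares the two.
  let τ : A ≃o Set.range μ :=
    (Fintype.orderIsoFinOfCardEq A rfl).symm.trans (Fintype.orderIsoFinOfCardEq _ hcard)
  refine ⟨τ.toEquiv.trans (Equiv.ofInjective μ hinj).symm, fun a => ⟨τ a, ?_, fun b' hb' => ?_⟩⟩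
  · obtain ⟨a', ha'⟩ := (τ a).2
    simp only [Function.comp, Equiv.symm_trans_apply, Equiv.symm_symm]
    change τ.symm _ = a
    rw [OrderIso.symm_apply_eq]
    ext
    simp [← ha', hμ]
  · simp only [Function.comp, Equiv.symm_trans_apply, Equiv.symm_symm]
    change τ.symm _ < a
    rw [OrderIso.symm_apply_lt, ← Subtype.coe_lt_coe]
    exact lt_of_le_of_lt (hμ' _ _ rfl) hb'

/-! ### Relatively free groups -/

theorem GroupTerm.map_eval {X : Type} {G H : Type u} [Group G] [Group H] (φ : G →* H) (a : X → G)
    (t : GroupTerm X) : φ (t.eval a) = t.eval fun x => φ (a x) := by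
  induction t with
  | var x => rfl
  | one => exact map_one φ
  | inv t ih => simp [GroupTerm.eval, ih]
  | mul s t hs ht => simp [GroupTerm.eval, hs, ht]

/-- The subgroup of `A ^ (A ^ n) × B ^ (B ^ n)` generated by the projections: the free group of rank
`n` in the variety generated by `A` and `B`. -/
def relFree (A B : Type u) [Group A] [Group B] (n : ℕ) :
    Subgroup (((Fin n → A) → A) × ((Fin n → B) → B)) :=
  Subgroup.closure (Set.range fun i => (fun g => g i, fun g => g i))

namespace relFree

variable {A B : Type u} [Group A] [Group B] {n : ℕ}

/-- The free generators. -/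
def gen (i : Fin n) : relFree A B n :=
  ⟨(fun g => g i, fun g => g i), Subgroup.subset_closure ⟨i, rfl⟩⟩

/-- The homomorphism to `A` with given values on the generators. -/
def liftFst (g : Fin n → A) : relFree A B n →* A :=
  ((Pi.evalMonoidHom (fun _ => A) g).comp (MonoidHom.fst _ _)).comp (relFree A B n).subtype

/-- The homomorphism to `B` with given values on the generators. -/
def liftSnd (g : Fin n → B) : relFree A B n →* B :=
  ((Pi.evalMonoidHom (fun _ => B) g).comp (MonoidHom.snd _ _)).comp (relFree A B n).subtype

@[simp] theorem liftFst_gen (g : Fin n → A) (i : Fin n) : liftFst (B := B) g (gen i) = g i := rfl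

@[simp] theorem liftSnd_gen (g : Fin n → B) (i : Fin n) : liftSnd (A := A) g (gen i) = g i := rfl

theorem comp_liftSnd (f : B →* A) (w : Fin n → B) :
    f.comp (liftSnd (A := A) w) = liftFst (f ∘ w) := by
  have key : Set.EqOn
      (f.comp ((Pi.evalMonoidHom (fun _ : Fin n → B => B) w).comp
        (MonoidHom.snd ((Fin n → A) → A) _)))
      ((Pi.evalMonoidHom (fun _ : Fin n → A => A) (f ∘ w)).comp (MonoidHom.fst _ _))
      (Set.range fun i => (fun g => g i, fun g => g i)) := by
    rintro _ ⟨i, rfl⟩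
    rfl
  ext x
  exact MonoidHom.eqOn_closure key x.2

theorem gen_injective [Nontrivial B] : Function.Injective (gen : Fin n → relFree A B n) := by
  classical
  intro i j h
  obtain ⟨b, hb⟩ := exists_ne (1 : B)
  have := congrArg (liftSnd (Pi.mulSingle i b)) h
  by_contra hne
  simp [Pi.mulSingle_eq_of_ne (Ne.symm hne)] at this
  exact hb this

/-- The homomorphisms `liftFst g` and `liftSnd g` jointly separate points, so identities pass from
`A` and `B` to the group. -/
theorem mem_variety {V : ObjectProperty GrpCat.{u}} (hV : IsGroupVariety V)
    (hA : V (GrpCat.of A)) (hB : V (GrpCat.of B)) : V (GrpCat.of (relFree A B n)) := by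
  obtain ⟨E, hE⟩ := hV
  refine (hE _).2 fun p hp a => ?_
  have h1 : ∀ g : Fin n → A, liftFst g (p.1.eval a) = liftFst g (p.2.eval a) := fun g => by
    rw [GroupTerm.map_eval, GroupTerm.map_eval]
    exact (hE _).1 hA p hp _
  have h2 : ∀ g : Fin n → B, liftSnd g (p.1.eval a) = liftSnd g (p.2.eval a) := fun g => by
    rw [GroupTerm.map_eval, GroupTerm.map_eval]
    exact (hE _).1 hB p hp _
  exact Subtype.ext (Prod.ext (funext h1) (funext h2))

end relFree

/-- A finite set has a linear order in which the values of a given injective family come first. -/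
theorem exists_linearOrder_isRigid {D : Type*} [Finite D] {n : ℕ} {ι : Fin n → D}
    (hι : Function.Injective ι) : ∃ _ : LinearOrder D, ∀ {B : Type u} [LinearOrder B] (f : D → B),
      IsRigid (f ∘ ι) → IsRigid f := by
  classical
  have := Fintype.ofFinite D
  -- Ranks: the family takes `0, …, n - 1` in its own order, and everything else starts at `n`.
  let κ : D → ℕ := fun d =>
    if h : ∃ i, ι i = d then (h.choose : ℕ) else n + Fintype.equivFin D d
  have hκι : ∀ i, κ (ι i) = i := fun i => by
    have h : ∃ j, ι j = ι i := ⟨i, rfl⟩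
    simp only [κ, dif_pos h]
    rw [hι h.choose_spec]
  have hκ : ∀ d, ∀ i : Fin n, κ d < i → ∃ j, ι j = d := fun d i hd => by
    by_contra h
    simp only [κ, dif_neg h] at hd
    omega
  have hinj : Function.Injective κ := by
    intro d e h
    by_cases hd : ∃ i, ι i = d
    · obtain ⟨i, rfl⟩ := hd
      by_cases he : ∃ i, ι i = e
      · obtain ⟨j, rfl⟩ := he
        rw [hκι, hκι] at h
        rw [Fin.ext h]
      · rw [hκι] at h
        simp only [κ, dif_neg he] at h
        omega
    · by_cases he : ∃ i, ι i = e
      · obtain ⟨j, rfl⟩ := he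
        rw [hκι] at h
        simp only [κ, dif_neg hd] at h
        omega
      · simp only [κ, dif_neg hd, dif_neg he] at h
        exact (Fintype.equivFin D).injective (Fin.ext (by omega))
  refine ⟨LinearOrder.lift' κ hinj, fun f hf b => ?_⟩
  obtain ⟨i, hi, hi'⟩ := hf b
  refine ⟨ι i, hi, fun d hd => ?_⟩
  have hd' : κ d < κ (ι i) := hd
  rw [hκι] at hd'
  obtain ⟨j, rfl⟩ := hκ d i hd'
  rw [hκι] at hd'
  exact hi' j hd'

/-! ### The Ramsey statements for groups -/

theorem ramseyArrow_self_of_subsingleton {C : Type u} [Category.{v} C] (A B : C) (k : ℕ)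
    [Subsingleton (A ⟶ B)] : RamseyArrow B B A k 1 := by
  refine fun χ => ⟨𝟙 B, Set.ncard_le_one_iff_subsingleton.2 ?_⟩
  rintro _ ⟨_, ⟨f, rfl⟩, rfl⟩ _ ⟨_, ⟨g, rfl⟩, rfl⟩
  rw [Subsingleton.elim f g]

theorem exists_rigid_lifts {V : ObjectProperty GrpCat.{u}} (hV : IsGroupVariety V)
    (A B : OrderedFiniteGroup V) [Nontrivial B.carrier] (n : ℕ) :
    ∃ (D : OrderedFiniteGroup V) (l₁ : (Fin n → A.carrier) → D.carrier →* A.carrier)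
      (l₂ : (Fin n → B.carrier) → D.carrier →* B.carrier),
      (∀ (f : B.carrier →* A.carrier) w, f.comp (l₂ w) = l₁ (f ∘ w)) ∧
        ∀ w, IsRigid w → IsRigid (l₂ w) := by
  obtain ⟨_, hD⟩ := exists_linearOrder_isRigid
    (relFree.gen_injective (A := A.carrier) (B := B.carrier) (n := n))
  exact ⟨⟨relFree A.carrier B.carrier n, relFree.mem_variety hV A.mem B.mem⟩, relFree.liftFst,
    relFree.liftSnd, relFree.comp_liftSnd, fun w hw => hD (relFree.liftSnd w) hw⟩

theorem hasDualRamseyProperty_orderedFiniteGroup {V : ObjectProperty GrpCat.{u}}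
    (hV : IsGroupVariety V) : HasDualRamseyProperty (OrderedFiniteGroup V) := by
  rintro k - ⟨A⟩ ⟨B⟩
  -- If `B` is trivial, the generators may coincide, but then there is at most one morphism to
  -- colour.
  rcases subsingleton_or_nontrivial B.carrier with hB | hB
  · have : Subsingleton (Opposite.op A ⟶ Opposite.op B) := by
      refine ⟨fun f g => Quiver.Hom.unop_inj (RigidEpi.ext (MonoidHom.ext fun x => ?_))⟩
      rw [Subsingleton.elim x 1, map_one, map_one]
    exact ⟨_, ramseyArrow_self_of_subsingleton _ _ k⟩
  · obtain ⟨n, hn⟩ := exists_mono_rigid A.carrier B.carrier (Option (Fin k))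
    obtain ⟨D, l₁, l₂, hl, hD⟩ := exists_rigid_lifts hV A B n
    refine ⟨Opposite.op D, fun χ => ?_⟩
    classical
    -- The colour `none` is for maps whose extension is not rigid; it never occurs on composites of
    -- morphisms.
    obtain ⟨w, hw, c, hc⟩ := hn fun g =>
      if hg : IsRigidSurjection fun x : D.carrier => l₁ g x then
        some (χ (Quiver.Hom.op (X := D) (Y := A) ⟨l₁ g, hg⟩)) else none
    let W : D ⟶ B := ⟨l₂ w, (hD w hw).isRigidSurjection⟩
    refine ⟨W.op, Set.ncard_le_one_iff_subsingleton.2 ?_⟩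
    have key : ∀ f : Opposite.op A ⟶ Opposite.op B, some (χ (f ≫ W.op)) = c := by
      intro f
      have e : (W ≫ f.unop).hom = l₁ (f.unop.hom ∘ w) :=
        hl f.unop.hom w
      have hg : IsRigidSurjection
          fun x : D.carrier => l₁ (f.unop.hom ∘ w) x := by
        rw [← e]
        exact (W ≫ f.unop).rigid
      rw [← hc _ f.unop.rigid.isRigid]
      change _ = dite _ _ _
      rw [dif_pos hg]
      congr 2
      exact Quiver.Hom.unop_inj (RigidEpi.ext e)
    rintro _ ⟨_, ⟨f, rfl⟩, rfl⟩ _ ⟨_, ⟨g, rfl⟩, rfl⟩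
    exact Option.some_injective _ ((key f).trans (key g).symm)

theorem smallRamseyDegree_lt_top {C : Type u} [Category.{v} C] {A : C} {n : ℕ} (hn : 1 ≤ n)
    (h : ∀ k : ℕ, 2 ≤ k → ∀ B : C, ∃ X : C, RamseyArrow X B A k n) : smallRamseyDegree A < ⊤ :=
  lt_of_le_of_lt (sInf_le (Set.mem_image_of_mem _ ⟨hn, h⟩)) (ENat.natCast_lt_top n)

theorem hasFiniteDualSmallRamseyDegrees_finiteGroup {V : ObjectProperty GrpCat.{u}}
    (hV : IsGroupVariety V) : HasFiniteDualSmallRamseyDegrees (FiniteGroup V) := by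
  rintro ⟨A⟩
  refine smallRamseyDegree_lt_top (n := Nat.card (Equiv.Perm A.carrier)) Nat.card_pos ?_
  rintro k - ⟨B⟩
  have := Fintype.ofFinite A.carrier
  have := Fintype.ofFinite B.carrier
  let _ : LinearOrder A.carrier :=
    LinearOrder.lift' _ (Fintype.equivFin A.carrier).injective
  let _ : LinearOrder B.carrier :=
    LinearOrder.lift' _ (Fintype.equivFin B.carrier).injective
  obtain ⟨n, hn⟩ := exists_mono_rigid A.carrier B.carrier
    (Equiv.Perm A.carrier → Option (Fin k))
  let D : FiniteGroup V := ⟨relFree A.carrier B.carrier n, relFree.mem_variety hV A.mem B.mem⟩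
  refine ⟨Opposite.op D, fun χ => ?_⟩
  classical
  -- A map is coloured by the colours of all its permuted versions at once, so the constant `c`
  -- gives one colour per permutation.
  obtain ⟨w, hw, c, hc⟩ := hn fun g σ =>
    if hg : Function.Surjective (relFree.liftFst (B := B.carrier) (σ ∘ g)) then
      some (χ (Quiver.Hom.op (X := D) (Y := A) ⟨relFree.liftFst (σ ∘ g), hg⟩)) else none
  let W : D ⟶ B := ⟨relFree.liftSnd w, fun b => by
    obtain ⟨i, hi, -⟩ := hw b
    exact ⟨relFree.gen i, hi⟩⟩
  refine ⟨W.op, ?_⟩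
  have key : ∀ f : Opposite.op A ⟶ Opposite.op B, some (χ (f ≫ W.op)) ∈ Set.range c := by
    intro f
    -- `σ.symm ∘ f` need not be a homomorphism, but the chain theorem concerns arbitrary rigid maps.
    obtain ⟨σ, hσ⟩ := exists_perm_isRigid f.unop.surjective
    have e : (W ≫ f.unop).hom = relFree.liftFst (σ ∘ (σ.symm ∘ f.unop.hom) ∘ w) := by
      refine (relFree.comp_liftSnd f.unop.hom w).trans (congrArg _ ?_)
      funext i
      simp
    have hg : Function.Surjective (relFree.liftFst (B := B.carrier)
        (σ ∘ (σ.symm ∘ f.unop.hom) ∘ w)) := by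
      rw [← e]
      exact (W ≫ f.unop).surjective
    refine ⟨σ, ?_⟩
    rw [← hc _ hσ]
    change dite _ _ _ = _
    rw [dif_pos hg]
    congr 2
    exact Quiver.Hom.unop_inj (GroupEpi.ext e.symm)
  have hsub : some '' (χ '' Set.range fun f : Opposite.op A ⟶ Opposite.op B => f ≫ W.op) ⊆
      Set.range c := by
    rintro _ ⟨_, ⟨_, ⟨f, rfl⟩, rfl⟩, rfl⟩
    exact key f
  rw [← Set.ncard_image_of_injective _ (Option.some_injective _)]
  refine (Set.ncard_le_ncard hsub (Set.toFinite _)).trans ?_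
  rw [← Set.image_univ, ← Set.ncard_univ]
  exact Set.ncard_image_le (Set.toFinite _)

theorem mainTheorem6 (V : ObjectProperty GrpCat.{u}) (hV : IsGroupVariety V)
    (hnt : IsNontrivialClass V) :
    HasDualRamseyProperty (OrderedFiniteGroup V) ∧
      HasFiniteDualSmallRamseyDegrees (FiniteGroup V) :=
  ⟨hasDualRamseyProperty_orderedFiniteGroup hV, hasFiniteDualSmallRamseyDegrees_finiteGroup hV⟩
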